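/- Let $\beta>0$ be real. For real $\alpha$ with $|\alpha\beta|>1$ let $d(\alpha,\beta;1)=(a_1,a_2,\dots)$ be the expansion of $1$ in the alternate base $(\beta_1,\beta_2,\dots)=(\alpha,\beta,\alpha,\beta,\dots)$ with $\gamma=0$, that is, $T^0=1$, $a_m=\lfloor \beta_m T^{m-1}\rfloor$ and $T^m=\beta_mT^{m-1}-a_m$ for $m\ge 1$. Let $\Phi(1,\beta)\subset\mathbb{C}$ be the set of all $\lambda$ with $|\lambda\beta|>1$ for which there is a real $\alpha$ with $|\alpha\beta|>1$ such that $d(\alpha,\beta;1)$ is eventually periodic, $\alpha$ is algebraic over $\mathbb{Q}(\beta)$, and $\lambda\ne\alpha$ is a conjugate of $\alpha$ over $\mathbb{Q}(\beta)$. Let $\overline{\Phi(1,\beta)}$ be its closure in $\mathbb{C}$. 1. If $\beta\ge 1$, then $$\overline{\Phi(1,\beta)}\cap\{\lambda\in\mathbb{C}:|\lambda|>1/\beta\}=\mathscr{G}(1,\beta)^{-1}:=\Big\{1/z:\ z\in\mathbb{C},\ |z|<\beta,\ 1+\sum_{j=1}^\infty\frac{d_j}{\beta^j}z^j=0\text{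 for some }d_1,d_2,\ldots\in[0,1]\Big\}.$$ 2. If $0<\beta<1$, then $$\overline{\Phi(1,\beta)}\cap\{\lambda\in\mathbb{C}:|\lambda|>1/\beta\}=\mathscr{G}'(1,\beta)^{-1}:=\Big\{1/z:\ z\in\mathbb{C},\ |z|<\beta,\ 1+\sum_{j=1}^\infty\frac{d_j}{\beta^j}z^j=0\text{ for some }d_1,d_2,\ldots\in[0,\beta]\Big\}.$$ -/

import Mathlib

open scoped IntermediateField

namespace CantorReal

/-- The maps `T^m` of the Cantor real expansion in the base `(B 0, B 1, B 2, …)`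
(so `B j` is the `(j+1)`-st base element) with offset `γ`:
`T^0 x = x` and `T^(m+1) x = B_m T^m x - ⌊B_m T^m x - γ⌋`. The same formula is used at the right
endpoint `x = γ + 1`. -/
noncomputable def T (γ : ℝ) (B : ℕ → ℝ) : ℕ → ℝ → ℝ
  | 0, x => x
  | m + 1, x => B m * T γ B m x - (⌊B m * T γ B m x - γ⌋ : ℤ)

/-- The digits of the expansion `d(B; x)`; `digit γ B x m` is the `(m+1)`-st digit
`⌊B_m T^m x - γ⌋`. -/
noncomputable def digit (γ : ℝ) (B : ℕ → ℝ) (x : ℝ) (m : ℕ) : ℤ :=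
  ⌊B m * T γ B m x - γ⌋

/-- The alternate base `(α, β, α, β, …)`. -/
noncomputable def altBase (α β : ℝ) (j : ℕ) : ℝ := if Even j then α else β

/-- Eventual periodicity of a digit sequence (finite expansions, ending in zeros, included). -/
def EventuallyPeriodic (a : ℕ → ℤ) : Prop :=
  ∃ p : ℕ, 0 < p ∧ ∃ k : ℕ, ∀ m : ℕ, k ≤ m → a (m + p) = a m

/-- `l` is a nontrivial conjugate of the real number `α` over the field `ℚ(β)`: `α` is algebraic
over `ℚ(β)`, and `l ≠ α` has the same minimal polynomial over `ℚ(β)`. -/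
def IsNontrivialConjugate (β α : ℝ) (l : ℂ) : Prop :=
  IsAlgebraic ℚ⟮(β : ℂ)⟯ (α : ℂ) ∧ IsConjRoot ℚ⟮(β : ℂ)⟯ (α : ℂ) l ∧ l ≠ (α : ℂ)

/-- The set `Φ(x, β)`: all nontrivial conjugates `l` over `ℚ(β)`, with `|l β| > 1`, of real numbers
`α` for which the expansion `d(α, β; x)` is defined (`|α β| > 1`) and eventually periodic. -/
def Phi (γ x β : ℝ) : Set ℂ :=
  {l | 1 < ‖l * (β : ℂ)‖ ∧ ∃ α : ℝ, 1 < |α * β| ∧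
    EventuallyPeriodic (digit γ (altBase α β) x) ∧ IsNontrivialConjugate β α l}

/-- The function `z ↦ x + ∑_{j ≥ 1} (d_j / β^j) z^j`. For bounded `d` the series converges
absolutely on the disc `|z| < |β|`, the only place where it is used. -/
noncomputable def seriesFun (x β : ℝ) (d : ℕ → ℝ) (z : ℂ) : ℂ :=
  (x : ℂ) + ∑' j : ℕ, ((d (j + 1) : ℂ) / (β : ℂ) ^ (j + 1)) * z ^ (j + 1)

/-- All functions `x + ∑_{j ≥ 1} (d_j / β^j) z^j` with every `d_j` in the set `D`. -/
def seriesFamily (D : Set ℝ) (x β : ℝ) : Set (ℂ → ℂ) :=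
  {f | ∃ d : ℕ → ℝ, (∀ j, 1 ≤ j → d j ∈ D) ∧ f = seriesFun x β d}

/-- The zeros of a family of functions in the disc `|z| < |β|`. -/
def zerosIn (β : ℝ) (F : Set (ℂ → ℂ)) : Set ℂ :=
  {z | ‖z‖ < |β| ∧ ∃ f ∈ F, f z = 0}

/-- `𝒢(x, β)`: coefficients `d_j ∈ [γ, γ + 1]`. -/
def G (γ x β : ℝ) : Set ℂ := zerosIn β (seriesFamily (Set.Icc γ (γ + 1)) x β)

/-- `𝒢'(x, β)`: coefficients `d_j ∈ [0, β]`. -/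
def G' (x β : ℝ) : Set ℂ := zerosIn β (seriesFamily (Set.Icc 0 β) x β)

/-- The set of reciprocals `{1 / z : z ∈ S}`. -/
noncomputable def recip (S : Set ℂ) : Set ℂ := (fun z => 1 / z) '' S

end CantorReal

/-!
The expansion of `1` is governed by the values `t_j = T^(2j) 1` after each full block `α, β`. They
satisfy `t_0 = 1`, `t_(j+1) = αβ t_j - b_j` with `b_j = β a_(2j+1) + a_(2j+2)`, and
`t_j ∈ [0, min 1 β)` for `j ≥ 1`. For `|w| < 1` the recursion sums to
`1 - ∑ b_j w^(j+1) = (1 - αβw) ∑ t_j w^j` (`CantorReal.hasSum_blockDigit`). The point `w = 1 / (αβ)`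
corresponds to `α` and `w = 1 / (βλ)` to a conjugate `λ`. In the variable `w`, for every `β`,
the question concerns the zeros in the unit disc of the series `1 + ∑ d_j w^j` with
`d_j ∈ [0, min 1 β]`.

*Conjugates give zeros.* If the digits are eventually periodic, the left-hand side is a rational
function over `ℚ(β)`. It vanishes at `1 / (αβ)`, hence at `1 / (βλ)`, where the factor `1 - αβw` is
nonzero; so `∑ t_j w^j` vanishes there (`CantorReal.exists_unitSeries_eq_zero_of_mem_Phi`). Compactness
of the space of coefficient sequences extends this to the closure
(`CantorReal.isClosed_zeros_unitSeries`).

*Zeros are limits of conjugates.* Zeros persist when finitely many coefficients are perturbed slightly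
and the others arbitrarily (`CantorReal.exists_zero_of_coeff_close`). A nested interval argument
produces large `α` with a finite expansion whose values `t_1, …, t_n` are close to given
`d_1, …, d_n`; since `αt_j` sweeps many integers while `α` runs through the remaining interval, the
digits can moreover be taken in prescribed residue classes
(`CantorReal.exists_finite_expansion`). Then `α` and the wanted `λ` are roots of one polynomial over
`ℚ(β)`, and it remains to make it irreducible. To this end `ℚ(β)` is embedded into some `ℚ_[p]` so that
`β` becomes a `p`-adic unit (`exists_ringHom_padic_norm_gen_eq_one`), and the residue classes of the
digits are chosen so that Eisenstein's criterion applies over `ℤ_[p]`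
(`companionPoly_irreducible_of_padic`).
-/

/-! ### Embedding a simple extension of `ℚ` into a `p`-adic field -/

open Polynomial in
/-- Bézout's identity for an integer polynomial that is separable over `ℚ` and its derivative, with
denominators cleared. -/
theorem Polynomial.exists_mul_add_mul_derivative_eq_C_int {f : ℤ[X]}
    (hf : (f.map (Int.castRingHom ℚ)).Separable) :
    ∃ r : ℤ, r ≠ 0 ∧ ∃ a b : ℤ[X], a * f + b * derivative f = C r := by
  obtain ⟨A, B, h⟩ := hf
  obtain ⟨m, hm, hA⟩ := IsLocalization.integerNormalization_spec (nonZeroDivisors ℤ) A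
  obtain ⟨n, hn, hB⟩ := IsLocalization.integerNormalization_spec (nonZeroDivisors ℤ) B
  set A' := IsLocalization.integerNormalization (nonZeroDivisors ℤ) A
  set B' := IsLocalization.integerNormalization (nonZeroDivisors ℤ) B
  refine ⟨m * n, mul_ne_zero (nonZeroDivisors.ne_zero hm) (nonZeroDivisors.ne_zero hn),
    C n * A', C m * B', ?_⟩
  apply map_injective (Int.castRingHom ℚ) Int.cast_injective
  have hA' : A'.map (Int.castRingHom ℚ) = C (m : ℚ) * A := by
    ext i
    simpa using congrArg (fun q => coeff q i) hA
  have hB' : B'.map (Int.castRingHom ℚ) = C (n : ℚ) * B := by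
    ext i
    simpa using congrArg (fun q => coeff q i) hB
  rw [derivative_map] at h
  simp only [Polynomial.map_add, Polynomial.map_mul, map_C, eq_intCast (Int.castRingHom ℚ),
    hA', hB', C_mul]
  linear_combination (C (m : ℚ) * C (n : ℚ)) * h

open Polynomial in
/-- A nonconstant integer polynomial with nonzero constant term has, for every nonzero `r`, a root
modulo some prime `p` that divides neither `r` nor the constant term. -/
theorem Polynomial.exists_prime_dvd_eval_not_dvd {f : ℤ[X]} (hd : 0 < f.natDegree)
    (h0 : f.coeff 0 ≠ 0) {r : ℤ} (hr : r ≠ 0) :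
    ∃ p : ℕ, p.Prime ∧ ∃ n : ℤ, (p : ℤ) ∣ f.eval n ∧ ¬ (p : ℤ) ∣ r ∧ ¬ (p : ℤ) ∣ f.coeff 0 := by
  set a := f.coeff 0 with ha
  have hfa : ∀ c : ℤ, f - C c ≠ 0 := by
    intro c h
    rw [sub_eq_zero.mp h] at hd
    simp at hd
  have hne : (f - C a) * (f - C (-a)) ≠ 0 := mul_ne_zero (hfa _) (hfa _)
  have hk : a ^ 2 * r ≠ 0 := mul_ne_zero (pow_ne_zero _ h0) hr
  -- Multiples `n = a² r x` satisfy `f(n) = a (1 + a r x g(n))`; a prime factor of the second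
  -- factor divides neither `a` nor `r`.
  obtain ⟨x, hx⟩ : ∃ x : ℤ, ((f - C a) * (f - C (-a))).eval (a ^ 2 * r * x) ≠ 0 := by
    by_contra! h
    refine hne (eq_zero_of_infinite_isRoot _ ((Set.infinite_range_of_injective
      (f := fun x : ℤ => a ^ 2 * r * x) fun x y hxy => mul_left_cancel₀ hk hxy).mono ?_))
    rintro _ ⟨x, rfl⟩
    exact h x
  set n := a ^ 2 * r * x with hn
  have hev : f.eval n = a * (1 + a * r * x * f.divX.eval n) := by
    conv_lhs => rw [← divX_mul_X_add f]
    simp only [eval_add, eval_mul, eval_X, eval_C]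
    rw [← ha]
    nth_rewrite 2 [hn]
    ring
  set v := 1 + a * r * x * f.divX.eval n with hv
  have hv1 : v.natAbs ≠ 1 := by
    intro h
    apply hx
    rcases Int.natAbs_eq_iff.mp h with h | h <;>
      simp [hev, h]
  obtain ⟨p, hp, hpv⟩ := Nat.exists_prime_and_dvd hv1
  have hpv' : (p : ℤ) ∣ v := Int.natCast_dvd.mpr hpv
  have key : ¬ (p : ℤ) ∣ a * r := by
    intro h
    have h1 : (p : ℤ) ∣ 1 := by
      have : (1 : ℤ) = v - a * r * (x * f.divX.eval n) := by rw [hv]; ring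
      rw [this]
      exact dvd_sub hpv' (h.mul_right _)
    exact hp.one_lt.ne' (by exact_mod_cast Int.eq_one_of_dvd_one (by positivity) h1)
  exact ⟨p, hp, n, hev ▸ hpv'.mul_left _, fun h => key (h.mul_left _), fun h => key (h.mul_right _)⟩

open Polynomial in
/-- An algebraic element of a characteristic zero field has, for a suitable prime `p`, a
conjugate among the units of `ℤ_[p]`. -/
theorem exists_padic_root_minpoly_norm_one {L : Type*} [Field L] [CharZero L] {b : L} (hb : b ≠ 0)
    (hi : IsIntegral ℚ b) :
    ∃ (p : ℕ) (_ : Fact p.Prime) (u : ℚ_[p]), ‖u‖ = 1 ∧ aeval u (minpoly ℚ b) = 0 := by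
  obtain ⟨m, hm, hf⟩ := IsLocalization.integerNormalization_spec (nonZeroDivisors ℤ) (minpoly ℚ b)
  set f := IsLocalization.integerNormalization (nonZeroDivisors ℤ) (minpoly ℚ b)
  have hm0 : (m : ℚ) ≠ 0 := by exact_mod_cast nonZeroDivisors.ne_zero hm
  have hf' : f.map (Int.castRingHom ℚ) = C (m : ℚ) * minpoly ℚ b := by
    ext i
    have := congrArg (fun q => coeff q i) hf
    simpa using this
  have hsep : (f.map (Int.castRingHom ℚ)).Separable := by
    rw [hf']
    exact ((minpoly.irreducible hi).separable).unit_mul (isUnit_C.mpr hm0.isUnit)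
  have hd : 0 < f.natDegree := by
    rw [← natDegree_map_eq_of_injective (f := Int.castRingHom ℚ) Int.cast_injective, hf',
      natDegree_C_mul hm0]
    exact minpoly.natDegree_pos hi
  have h0 : f.coeff 0 ≠ 0 := by
    have h1 : ((f.coeff 0 : ℤ) : ℚ) = m * (minpoly ℚ b).coeff 0 := by
      have := congrArg (fun q => coeff q 0) hf'
      simpa using this
    intro h
    rw [h, Int.cast_zero, eq_comm, mul_eq_zero] at h1
    exact (h1.resolve_left hm0) |> minpoly.coeff_zero_ne_zero hi hb
  obtain ⟨r, hr, A, B, hAB⟩ := exists_mul_add_mul_derivative_eq_C_int hsep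
  obtain ⟨p, hp, n, hpn, hpr, hp0⟩ := exists_prime_dvd_eval_not_dvd hd h0 hr
  have : Fact p.Prime := ⟨hp⟩
  have hev : ∀ g : ℤ[X], aeval (n : ℤ_[p]) g = ((g.eval n : ℤ) : ℤ_[p]) := by
    intro g
    have := aeval_algebraMap_apply_eq_algebraMap_eval (A := ℤ_[p]) n g
    simpa using this
  have hder : ‖aeval (n : ℤ_[p]) (derivative f)‖ = 1 := by
    rw [hev]
    refine le_antisymm (PadicInt.norm_le_one _) (not_lt.mp fun h => hpr ?_)
    rw [PadicInt.norm_int_lt_one_iff_dvd] at h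
    have := congrArg (eval n) hAB
    simp only [eval_add, eval_mul, eval_C] at this
    rw [← this]
    exact dvd_add (hpn.mul_left _) (h.mul_left _)
  obtain ⟨z, hz, -⟩ := hensels_lemma (p := p) (F := f) (a := (n : ℤ_[p])) (by
    rw [hder, hev, one_pow]
    exact (PadicInt.norm_int_lt_one_iff_dvd _).mpr hpn)
  refine ⟨p, this, z, ?_, ?_⟩
  · refine le_antisymm (PadicInt.norm_le_one _) (not_lt.mp fun h => hp0 ?_)
    -- `f(z) = 0` expresses the constant term as a multiple of `z`.
    have h1 : ((f.coeff 0 : ℤ) : ℤ_[p]) = -(aeval z f.divX * z) := by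
      have h2 := congrArg (aeval z) (divX_mul_X_add f)
      simp only [map_add, map_mul, aeval_X, hz, aeval_C, eq_intCast (algebraMap ℤ ℤ_[p])] at h2
      linear_combination h2
    rw [← PadicInt.norm_int_lt_one_iff_dvd, h1, norm_neg, norm_mul]
    exact (mul_le_of_le_one_left (norm_nonneg _) (PadicInt.norm_le_one _)).trans_lt h
  · have h1 : aeval (z : ℚ_[p]) (f.map (Int.castRingHom ℚ)) = 0 := by
      have h2 := congrArg (algebraMap ℤ_[p] ℚ_[p]) hz
      rw [← aeval_algebraMap_apply, map_zero] at h2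
      rw [← h2]
      exact aeval_map_algebraMap ℚ (z : ℚ_[p]) f
    rw [hf', map_mul, aeval_C, mul_eq_zero] at h1
    refine h1.resolve_left ?_
    simpa using hm0

open Polynomial IntermediateField algebraAdjoinAdjoin in
/-- A simple extension of `ℚ` embeds into some `ℚ_[p]` in such a way that its (nonzero) generator
becomes a unit of `ℤ_[p]`. -/
theorem exists_ringHom_padic_norm_gen_eq_one {L : Type*} [Field L] [CharZero L] {b : L}
    (hb : b ≠ 0) :
    ∃ (p : ℕ) (_ : Fact p.Prime) (φ : ℚ⟮b⟯ →+* ℚ_[p]), ‖φ (AdjoinSimple.gen ℚ b)‖ = 1 := by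
  by_cases hi : IsIntegral ℚ b
  · obtain ⟨p, hp, u, hu, hr⟩ := exists_padic_root_minpoly_norm_one hb hi
    refine ⟨p, hp, ((algHomAdjoinIntegralEquiv ℚ hi).symm
      ⟨u, mem_aroots.mpr ⟨minpoly.ne_zero hi, hr⟩⟩).toRingHom, ?_⟩
    rw [← hu]
    congr 1
    exact algHomAdjoinIntegralEquiv_symm_apply_gen ℚ hi _
  · have ht : Transcendental ℚ b := fun h => hi h.isIntegral
    have : Fact (Nat.Prime 2) := ⟨Nat.prime_two⟩
    obtain ⟨u, hu, hut⟩ : ∃ u : ℚ_[2], ‖u‖ = 1 ∧ Transcendental ℚ u := by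
      by_contra! h
      have ho : IsOpen {u : ℚ_[2] | ‖u‖ = 1} := by
        have := IsUltrametricDist.isOpen_sphere (0 : ℚ_[2]) one_ne_zero
        simpa [Metric.sphere] using this
      have hcard := continuum_le_cardinal_of_isOpen ℚ_[2] ho ⟨1, by simp⟩
      have hc : {u : ℚ_[2] | ‖u‖ = 1}.Countable :=
        (Algebraic.countable ℚ ℚ_[2]).mono fun u hu => not_not.mp (h u hu)
      exact absurd (hcard.trans hc.le_aleph0) (not_le.mpr Cardinal.aleph0_lt_continuum)
    let ψ : Algebra.adjoin ℚ {b} →+* ℚ_[2] := (aeval u : ℚ[X] →ₐ[ℚ] ℚ_[2]).toRingHom.comp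
      (Polynomial.algEquivOfTranscendental ℚ b ht).symm.toRingHom
    have hψ : Function.Injective ψ :=
      (transcendental_iff_injective.mp hut).comp
        (Polynomial.algEquivOfTranscendental ℚ b ht).symm.injective
    refine ⟨2, this, IsFractionRing.lift hψ, ?_⟩
    have hgen : AdjoinSimple.gen ℚ b = algebraMap (Algebra.adjoin ℚ {b}) ℚ⟮b⟯
        ⟨b, Algebra.self_mem_adjoin_singleton ℚ b⟩ := rfl
    rw [hgen, IsFractionRing.lift_algebraMap, ← hu]
    congr 1
    change aeval u ((Polynomial.algEquivOfTranscendental ℚ b ht).symm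
      ⟨b, Algebra.self_mem_adjoin_singleton ℚ b⟩) = u
    rw [Polynomial.algEquivOfTranscendental_symm_gen, aeval_X]

/-! ### An Eisenstein criterion at a `p`-adic place -/

open Polynomial in
/-- The polynomial `X^N - ∑_{i < N} e_i X^(N-1-i)`. -/
noncomputable def companionPoly {R : Type*} [CommRing R] (N : ℕ) (e : ℕ → R) : R[X] :=
  X ^ N - ∑ i ∈ Finset.range N, C (e i) * X ^ (N - 1 - i)

namespace companionPoly
open Polynomial

variable {R S : Type*} [CommRing R] [CommRing S] (N : ℕ) (e : ℕ → R)

theorem degree_sum_lt :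
    (∑ i ∈ Finset.range N, C (e i) * X ^ (N - 1 - i) : R[X]).degree < (N : WithBot ℕ) := by
  rw [degree_lt_iff_coeff_zero]
  intro m hm
  rw [finsetSum_coeff]
  refine Finset.sum_eq_zero fun i hi => ?_
  rw [coeff_C_mul_X_pow, if_neg]
  have := Finset.mem_range.mp hi
  omega

theorem monic : (companionPoly N e).Monic := monic_X_pow_sub (degree_sum_lt N e)

theorem map (φ : R →+* S) : (companionPoly N e).map φ = companionPoly N fun i => φ (e i) := by
  simp [companionPoly, Polynomial.map_sum]

theorem natDegree [Nontrivial R] : (companionPoly N e).natDegree = N := by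
  refine natDegree_eq_of_degree_eq_some ?_
  rw [companionPoly, degree_sub_eq_left_of_degree_lt] <;> rw [degree_X_pow]
  exact degree_sum_lt N e

theorem coeff_of_lt {m : ℕ} (hm : m < N) : (companionPoly N e).coeff m = - e (N - 1 - m) := by
  rw [companionPoly, coeff_sub, coeff_X_pow, if_neg hm.ne, zero_sub, finsetSum_coeff, neg_inj,
    Finset.sum_eq_single (N - 1 - m)]
  · rw [coeff_C_mul_X_pow, if_pos (by omega)]
  · intro i hi hne
    have := Finset.mem_range.mp hi
    rw [coeff_C_mul_X_pow, if_neg (by omega)]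
  · intro h
    exact absurd (Finset.mem_range.mpr (by omega)) h

theorem irreducible_of_eisenstein [IsDomain R] {P : Ideal R} (hP : P.IsPrime)
    (hN : 0 < N) (he : ∀ i < N, e i ∈ P) (hl : e (N - 1) ∉ P ^ 2) :
    Irreducible (companionPoly N e) := by
  refine IsEisensteinAt.irreducible (𝓟 := P) ⟨?_, ?_, ?_⟩ hP (monic N e).isPrimitive ?_
  · rw [(monic N e).leadingCoeff]
    exact fun h => hP.ne_top ((Ideal.eq_top_iff_one P).mpr h)
  · intro n hn
    rw [natDegree] at hn
    rw [coeff_of_lt N e hn]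
    exact neg_mem (he _ (by omega))
  · rw [coeff_of_lt N e hN, neg_mem_iff]
    exact hl
  · rwa [natDegree]

end companionPoly

/-- Eisenstein's criterion at a `p`-adic place: `b` is a unit there, `p ∣ c_i` for all `i < N` and
`p² ∤ c_(N-1)`. -/
theorem companionPoly_irreducible_of_padic {K : Type*} [Field K] {p : ℕ} [Fact p.Prime]
    (φ : K →+* ℚ_[p]) {b : K} (hb : ‖φ b‖ = 1) {N : ℕ} (hN : 0 < N) {c : ℕ → ℤ}
    (hc : ∀ i < N, (p : ℤ) ∣ c i) (hl : ¬ (p : ℤ) ^ 2 ∣ c (N - 1)) :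
    Irreducible (companionPoly N fun i => (c i : K) * (b⁻¹) ^ i) := by
  have hb' : ‖(φ b)⁻¹‖ = 1 := by rw [norm_inv, hb, inv_one]
  set u : ℤ_[p] := ⟨(φ b)⁻¹, hb'.le⟩ with hu
  have hunit : IsUnit u := PadicInt.isUnit_iff.mpr hb'
  refine (companionPoly.monic N _).irreducible_of_irreducible_map φ _ ?_
  have hmap : (companionPoly N fun i => (c i : K) * (b⁻¹) ^ i).map φ
      = (companionPoly N fun i => (c i : ℤ_[p]) * u ^ i).map (algebraMap ℤ_[p] ℚ_[p]) := by
    rw [companionPoly.map, companionPoly.map]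
    congr 1
    ext i
    have : ((u : ℤ_[p]) : ℚ_[p]) = (φ b)⁻¹ := rfl
    simp [PadicInt.algebraMap_apply, this]
  rw [hmap, ← (companionPoly.monic N _).irreducible_iff_irreducible_map_fraction_map]
  have hdvd : ∀ (z : ℤ) (k i : ℕ), (z : ℤ_[p]) * u ^ i ∈ Ideal.span {(p : ℤ_[p]) ^ k} ↔
      (p : ℤ) ^ k ∣ z := by
    intro z k i
    rw [Ideal.mem_span_singleton, (hunit.pow i).dvd_mul_right, PadicInt.pow_p_dvd_int_iff]
  have hP : (Ideal.span {(p : ℤ_[p])}).IsPrime := by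
    rw [Ideal.span_singleton_prime (by exact_mod_cast (Fact.out : p.Prime).ne_zero)]
    exact PadicInt.prime_p
  refine companionPoly.irreducible_of_eisenstein N _ hP hN (fun i hi => ?_) ?_
  · simpa using (hdvd (c i) 1 i).mpr (by simpa using hc i hi)
  · rw [Ideal.span_singleton_pow, hdvd]
    exact hl

/-! ### Expansions of `1` with prescribed orbit -/

namespace CantorReal

theorem T_succ (γ : ℝ) (B : ℕ → ℝ) (x : ℝ) (m : ℕ) :
    T γ B (m + 1) x = B m * T γ B m x - digit γ B x m := rfl

theorem T_succ_eq_fract (B : ℕ → ℝ) (x : ℝ) (m : ℕ) :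
    T 0 B (m + 1) x = Int.fract (B m * T 0 B m x) := by
  rw [T_succ, digit, sub_zero, Int.fract]

theorem digit_eq_floor (B : ℕ → ℝ) (x : ℝ) (m : ℕ) :
    digit 0 B x m = ⌊B m * T 0 B m x⌋ := by
  rw [digit, sub_zero]

theorem T_eq_zero_of_le {B : ℕ → ℝ} {x : ℝ} {m n : ℕ} (hm : T 0 B m x = 0) (hmn : m ≤ n) :
    T 0 B n x = 0 := by
  induction n, hmn using Nat.le_induction with
  | base => exact hm
  | succ n _ ih => rw [T_succ_eq_fract, ih, mul_zero, Int.fract_zero]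

theorem digit_eq_zero_of_le {B : ℕ → ℝ} {x : ℝ} {m n : ℕ} (hm : T 0 B m x = 0) (hmn : m ≤ n) :
    digit 0 B x n = 0 := by
  rw [digit_eq_floor, T_eq_zero_of_le hm hmn, mul_zero, Int.floor_zero]

theorem altBase_even (α β : ℝ) (j : ℕ) : altBase α β (2 * j) = α := by simp [altBase]

theorem altBase_odd (α β : ℝ) (j : ℕ) : altBase α β (2 * j + 1) = β := by simp [altBase]

/-- The orbit of `1` in the base `(α, β, α, β, …)` with `γ = 0`, observed after each full block
`α, β`: `evenT α β j = T^(2j) 1`. -/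
noncomputable def evenT (α β : ℝ) (j : ℕ) : ℝ := T 0 (altBase α β) (2 * j) 1

/-- The contribution `β a_(2j+1) + a_(2j+2)` of a block of two digits `a_(2j+1)`, `a_(2j+2)` of the
expansion of `1`. -/
noncomputable def blockDigit (α β : ℝ) (j : ℕ) : ℝ :=
  β * digit 0 (altBase α β) 1 (2 * j) + digit 0 (altBase α β) 1 (2 * j + 1)

@[simp]
theorem evenT_zero (α β : ℝ) : evenT α β 0 = 1 := rfl

theorem evenT_succ (α β : ℝ) (j : ℕ) :
    evenT α β (j + 1) = α * β * evenT α β j - blockDigit α β j := by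
  rw [evenT, show 2 * (j + 1) = 2 * j + 1 + 1 by ring, T_succ, T_succ, altBase_even, altBase_odd,
    blockDigit, evenT]
  ring

theorem evenT_nonneg (α β : ℝ) (j : ℕ) : 0 ≤ evenT α β j := by
  cases j with
  | zero => simp
  | succ j =>
    rw [evenT, show 2 * (j + 1) = 2 * j + 1 + 1 by ring, T_succ_eq_fract]
    exact Int.fract_nonneg _

/-- For `β < 1` the second digit of each block vanishes and `T^(2j+2)` is `β` times a number
in `[0, 1)`. -/
theorem evenT_succ_lt (α : ℝ) {β : ℝ} (hβ : 0 < β) (j : ℕ) : evenT α β (j + 1) < min 1 β := by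
  rw [evenT, show 2 * (j + 1) = 2 * j + 1 + 1 by ring, T_succ_eq_fract, altBase_odd,
    T_succ_eq_fract]
  set y := Int.fract (altBase α β (2 * j) * T 0 (altBase α β) (2 * j) 1)
  have hy0 : 0 ≤ y := Int.fract_nonneg _
  have hy1 : y < 1 := Int.fract_lt_one _
  refine lt_min (Int.fract_lt_one _) ?_
  have hfl : (0 : ℝ) ≤ ⌊β * y⌋ := by
    exact_mod_cast Int.floor_nonneg.mpr (mul_nonneg hβ.le hy0)
  have : Int.fract (β * y) = β * y - ⌊β * y⌋ := rfl
  nlinarith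

theorem evenT_le_one (α : ℝ) {β : ℝ} (hβ : 0 < β) (j : ℕ) : evenT α β j ≤ 1 := by
  cases j with
  | zero => simp
  | succ j => exact ((evenT_succ_lt α hβ j).trans_le (min_le_left _ _)).le

/-- One block of the expansion, when its first digit is `c` and its second digit is `0`. -/
theorem block_of_mem {α β : ℝ} (hβ : 0 < β) {j : ℕ} {c : ℤ}
    (h0 : 0 ≤ β * (α * evenT α β j - c)) (h1 : β * (α * evenT α β j - c) < min 1 β) :
    digit 0 (altBase α β) 1 (2 * j) = c ∧ digit 0 (altBase α β) 1 (2 * j + 1) = 0 ∧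
      evenT α β (j + 1) = β * (α * evenT α β j - c) := by
  have hx0 : 0 ≤ α * evenT α β j - c := nonneg_of_mul_nonneg_right h0 hβ
  have hx1 : α * evenT α β j - c < 1 := by
    have := h1.trans_le (min_le_right _ _)
    by_contra! hc
    nlinarith
  have hd : digit 0 (altBase α β) 1 (2 * j) = c := by
    rw [digit_eq_floor, altBase_even, Int.floor_eq_iff]
    change (c : ℝ) ≤ α * evenT α β j ∧ α * evenT α β j < c + 1
    constructor <;> linarith
  have hT : T 0 (altBase α β) (2 * j + 1) 1 = α * evenT α β j - c := by
    rw [T_succ, hd, altBase_even, evenT]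
  have hd' : digit 0 (altBase α β) 1 (2 * j + 1) = 0 := by
    rw [digit_eq_floor, altBase_odd, hT, Int.floor_eq_zero_iff]
    exact ⟨h0, h1.trans_le (min_le_left _ _)⟩
  refine ⟨hd, hd', ?_⟩
  rw [evenT, show 2 * (j + 1) = 2 * j + 1 + 1 by ring, T_succ, hd', altBase_odd, hT, Int.cast_zero,
    sub_zero]

theorem exists_int_mem_of_length {x y : ℝ} {m : ℕ} (hm : 0 < m) (h : x + (m + 1) ≤ y) (r : ℤ) :
    ∃ c : ℤ, (m : ℤ) ∣ c - r ∧ x ≤ c ∧ (c : ℝ) + 1 ≤ y := by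
  have hm' : (0 : ℝ) < m := by exact_mod_cast hm
  refine ⟨r + m * ⌈(x - r) / m⌉, ⟨⌈(x - r) / m⌉, by ring⟩, ?_, ?_⟩
  · have := Int.le_ceil ((x - r) / m)
    rw [div_le_iff₀ hm'] at this
    push_cast
    linarith
  · have := Int.ceil_lt_add_one ((x - r) / m)
    rw [← sub_lt_iff_lt_add, lt_div_iff₀ hm'] at this
    push_cast
    linarith

/-- Nested intervals: there are intervals of arbitrarily large `α` on which the first `j` blocks have
first digit divisible by `q` and second digit `0`, the values `T^2, …, T^(2j)` lie in prescribed
intervals `[l i, h i]` inside `[0, min 1 β)`, and `α T^(2j)` is a continuous increasing function of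
`α` with a range of length at least `q² + 1`. The range is long because `α` is large and `T^(2j)`
fills its whole interval; this leaves the next digit free modulo `q` or `q²`. -/
theorem exists_interval {β : ℝ} (hβ : 0 < β) {l h : ℕ → ℝ} {κ : ℝ} (hκ : 0 < κ)
    (hl : ∀ i, 0 ≤ l i) (hlh : ∀ i, l i + κ ≤ h i) (hh : ∀ i, h i < min 1 β)
    {q : ℕ} (hq : 0 < q) {A : ℝ} (hA : 0 < A) (hAκ : (q : ℝ) ^ 2 + 1 ≤ A * κ) (j : ℕ) :
    ∃ u v : ℝ, A ≤ u ∧ u ≤ v ∧ ContinuousOn (fun α => α * evenT α β j) (Set.Icc u v) ∧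
      MonotoneOn (fun α => α * evenT α β j) (Set.Icc u v) ∧
      u * evenT u β j + ((q : ℝ) ^ 2 + 1) ≤ v * evenT v β j ∧
      ∀ α ∈ Set.Icc u v, ∀ i < j, (q : ℤ) ∣ digit 0 (altBase α β) 1 (2 * i) ∧
        digit 0 (altBase α β) 1 (2 * i + 1) = 0 ∧ evenT α β (i + 1) ∈ Set.Icc (l i) (h i) := by
  induction j with
  | zero =>
    refine ⟨A, A + ((q : ℝ) ^ 2 + 1), le_rfl, by nlinarith, ?_, ?_, ?_, ?_⟩
    · simp only [evenT_zero, mul_one]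
      exact continuousOn_id
    · simp only [evenT_zero, mul_one]
      exact monotoneOn_id
    · simp
    · simp
  | succ j ih =>
    obtain ⟨u, v, hAu, huv, hc, hmono, hspan, hgood⟩ := ih
    have hqq : (q : ℝ) + 1 ≤ (q : ℝ) ^ 2 + 1 := by
      have : (1 : ℝ) ≤ q := by exact_mod_cast hq
      nlinarith
    obtain ⟨c, hcq, hcu, hcv⟩ := exists_int_mem_of_length hq
      (show u * evenT u β j + ((q : ℝ) + 1) ≤ v * evenT v β j by linarith) 0
    rw [sub_zero] at hcq
    have hl0 : 0 ≤ l j / β := div_nonneg (hl j) hβ.le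
    have hh1 : h j / β < 1 := (div_lt_one hβ).mpr ((hh j).trans_le (min_le_right _ _))
    have hlh' : l j / β ≤ h j / β := by
      have := hlh j
      gcongr
      linarith
    obtain ⟨u', hu', hu'eq⟩ := intermediate_value_Icc huv hc
      (show c + l j / β ∈ Set.Icc _ _ from ⟨by linarith, by linarith⟩)
    obtain ⟨v', hv', hv'eq⟩ := intermediate_value_Icc hu'.2
      (hc.mono (Set.Icc_subset_Icc_left hu'.1))
      (show c + h j / β ∈ Set.Icc _ _ from ⟨by simp only [hu'eq]; linarith, by linarith⟩)
    simp only at hu'eq hv'eq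
    have hsub : Set.Icc u' v' ⊆ Set.Icc u v := Set.Icc_subset_Icc hu'.1 hv'.2
    have hl' : β * (l j / β) = l j := by field_simp
    have hh' : β * (h j / β) = h j := by field_simp
    have hmem : ∀ α ∈ Set.Icc u' v', β * (α * evenT α β j - c) ∈ Set.Icc (l j) (h j) := by
      intro α hα
      have h1 : u' * evenT u' β j ≤ α * evenT α β j := hmono hu' (hsub hα) hα.1
      have h2 : α * evenT α β j ≤ v' * evenT v' β j :=
        hmono (hsub hα) (hsub ⟨hv'.1, le_rfl⟩) hα.2
      rw [hu'eq] at h1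
      rw [hv'eq] at h2
      constructor
      · rw [← hl']; gcongr; linarith
      · rw [← hh']; gcongr; linarith
    have hblock : ∀ α ∈ Set.Icc u' v', _ := fun α hα =>
      block_of_mem (α := α) hβ (j := j) (c := c) ((hl j).trans (hmem α hα).1)
        ((hmem α hα).2.trans_lt (hh j))
    have hpos : ∀ α ∈ Set.Icc u' v', 0 ≤ α := fun α hα =>
      hA.le.trans (hAu.trans (hu'.1.trans hα.1))
    refine ⟨u', v', hAu.trans hu'.1, hv'.1, ?_, ?_, ?_, ?_⟩
    · have : ContinuousOn (fun α => α * (β * (α * evenT α β j - c))) (Set.Icc u' v') :=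
        continuousOn_id.mul (continuousOn_const.mul ((hc.mono hsub).sub continuousOn_const))
      exact this.congr fun α hα => by simp only [(hblock α hα).2.2]
    · intro α hα α' hα' hle
      have h1 : α * evenT α β j ≤ α' * evenT α' β j := hmono (hsub hα) (hsub hα') hle
      simp only [(hblock α hα).2.2, (hblock α' hα').2.2]
      exact mul_le_mul hle (by gcongr) ((hl j).trans (hmem α hα).1) (hpos α' hα')
    · rw [(hblock u' ⟨le_rfl, hv'.1⟩).2.2, (hblock v' ⟨hv'.1, le_rfl⟩).2.2, hu'eq, hv'eq,
        add_sub_cancel_left, add_sub_cancel_left, hl', hh']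
      have h1 := hlh j
      have h2 := hl j
      have h3 : A * κ ≤ u' * κ := by gcongr; exact hAu.trans hu'.1
      have h4 : u' * h j ≤ v' * h j := by gcongr; exacts [by linarith, hv'.1]
      have h5 : u' * (l j + κ) ≤ u' * h j := by
        gcongr
        exact hpos u' ⟨le_rfl, hv'.1⟩
      nlinarith
    · intro α hα i hi
      rcases Nat.lt_succ_iff_lt_or_eq.mp hi with hi | rfl
      · exact hgood α (hsub hα) i hi
      · obtain ⟨hd, hd', hT⟩ := hblock α hα
        exact ⟨hd ▸ hcq, hd', hT ▸ hmem α hα⟩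

/-- There are arbitrarily large `α` for which the expansion of `1` is finite, its block values
`T^2, …, T^(2n)` lie in prescribed intervals, `T^(2n+2) = 0`, the second digit of every block is `0`,
and the first digits satisfy the divisibility conditions of Eisenstein's criterion at `q`. -/
theorem exists_finite_expansion {β : ℝ} (hβ : 0 < β) {l h : ℕ → ℝ} {κ : ℝ} (hκ : 0 < κ)
    (hl : ∀ i, 0 ≤ l i) (hlh : ∀ i, l i + κ ≤ h i) (hh : ∀ i, h i < min 1 β)
    {q : ℕ} (hq : 1 < q) (A : ℝ) (n : ℕ) :
    ∃ α : ℝ, A ≤ α ∧ (∀ i < n, evenT α β (i + 1) ∈ Set.Icc (l i) (h i)) ∧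
      (∀ i, digit 0 (altBase α β) 1 (2 * i + 1) = 0) ∧
      (∀ i < n + 1, (q : ℤ) ∣ digit 0 (altBase α β) 1 (2 * i)) ∧
      ¬ (q : ℤ) ^ 2 ∣ digit 0 (altBase α β) 1 (2 * n) ∧
      T 0 (altBase α β) (2 * (n + 1)) 1 = 0 := by
  set A' := max A (max 1 (((q : ℝ) ^ 2 + 1) / κ)) with hA'
  have hA'0 : 0 < A' := lt_of_lt_of_le one_pos ((le_max_left _ _).trans (le_max_right _ _))
  have hA'κ : (q : ℝ) ^ 2 + 1 ≤ A' * κ := by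
    rw [← div_le_iff₀ hκ]
    exact (le_max_right _ _).trans (le_max_right _ _)
  obtain ⟨u, v, hAu, huv, hc, -, hspan, hgood⟩ :=
    exists_interval hβ hκ hl hlh hh (zero_lt_one.trans hq) hA'0 hA'κ n
  obtain ⟨c, hcq, hcu, hcv⟩ := exists_int_mem_of_length (m := q ^ 2) (by positivity)
    (show u * evenT u β n + (((q ^ 2 : ℕ) : ℝ) + 1) ≤ v * evenT v β n by push_cast; linarith)
    (q : ℤ)
  push_cast at hcq
  obtain ⟨α, hα, hαeq⟩ := intermediate_value_Icc huv hc
    (show (c : ℝ) ∈ Set.Icc _ _ from ⟨hcu, by linarith⟩)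
  simp only at hαeq
  have hzero : β * (α * evenT α β n - c) = 0 := by rw [hαeq, sub_self, mul_zero]
  obtain ⟨hd, hd', hT⟩ := block_of_mem (α := α) hβ (j := n) (c := c) hzero.ge
    (hzero.trans_lt (lt_min one_pos hβ))
  rw [hzero] at hT
  refine ⟨α, (le_max_left _ _).trans (hAu.trans hα.1), fun i hi => (hgood α hα i hi).2.2,
    fun i => ?_, fun i hi => ?_, ?_, hT⟩
  · rcases lt_trichotomy i n with hi | rfl | hi
    · exact (hgood α hα i hi).2.1
    · exact hd'
    · exact digit_eq_zero_of_le hT (by omega)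
  · rcases Nat.lt_succ_iff_lt_or_eq.mp hi with hi | rfl
    · exact (hgood α hα i hi).1
    · rw [hd]
      have h1 : (q : ℤ) ∣ c - q := (dvd_pow_self _ two_ne_zero).trans hcq
      simpa using dvd_add h1 (dvd_refl (q : ℤ))
  · rw [hd]
    intro hdvd
    have h1 : (q : ℤ) ^ 2 ∣ q := by simpa using dvd_sub hdvd hcq
    have h2 := Int.le_of_dvd (by omega) h1
    nlinarith

/-! ### Power series with bounded coefficients in the unit disc -/

/-- The power series `1 + ∑_{j ≥ 1} d_j w^j`, which is `seriesFun 1 β d` in the rescaled variable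
`w = z / β` of the unit disc. -/
noncomputable def unitSeries (d : ℕ → ℝ) (w : ℂ) : ℂ := 1 + ∑' j : ℕ, (d (j + 1) : ℂ) * w ^ (j + 1)

theorem seriesFun_eq_unitSeries (β : ℝ) (d : ℕ → ℝ) (z : ℂ) :
    seriesFun 1 β d z = unitSeries d (z / β) := by
  simp only [seriesFun, unitSeries, Complex.ofReal_one, div_pow]
  congr 2
  ext j
  ring

theorem unitSeries_zero (d : ℕ → ℝ) : unitSeries d 0 = 1 := by
  simp [unitSeries]

theorem norm_term_le {d : ℕ → ℝ} (hd : ∀ j, |d (j + 1)| ≤ 1) {w : ℂ} {ρ : ℝ} (hw : ‖w‖ ≤ ρ) (j : ℕ) :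
    ‖(d (j + 1) : ℂ) * w ^ (j + 1)‖ ≤ ρ ^ (j + 1) := by
  rw [norm_mul, norm_pow, Complex.norm_real, Real.norm_eq_abs]
  exact (mul_le_of_le_one_left (by positivity) (hd j)).trans (by gcongr)

theorem summable_pow_succ {ρ : ℝ} (h0 : 0 ≤ ρ) (h1 : ρ < 1) : Summable fun j : ℕ => ρ ^ (j + 1) :=
  (summable_nat_add_iff 1).mpr (summable_geometric_of_lt_one h0 h1)

theorem summable_term {d : ℕ → ℝ} (hd : ∀ j, |d (j + 1)| ≤ 1) {w : ℂ} (hw : ‖w‖ < 1) :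
    Summable fun j : ℕ => (d (j + 1) : ℂ) * w ^ (j + 1) :=
  .of_norm_bounded (summable_pow_succ (norm_nonneg w) hw) (norm_term_le hd le_rfl)

theorem differentiableOn_unitSeries {d : ℕ → ℝ} (hd : ∀ j, |d (j + 1)| ≤ 1) :
    DifferentiableOn ℂ (unitSeries d) (Metric.ball 0 1) := by
  intro w hw
  rw [mem_ball_zero_iff] at hw
  obtain ⟨ρ, hρ, hρ1⟩ := exists_between hw
  have h : DifferentiableOn ℂ (fun w => ∑' j : ℕ, (d (j + 1) : ℂ) * w ^ (j + 1))
      (Metric.ball 0 ρ) := by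
    refine Complex.differentiableOn_tsum_of_summable_norm
      (summable_pow_succ ((norm_nonneg w).trans hρ.le) hρ1) (fun j => by fun_prop)
      Metric.isOpen_ball fun j w hw => norm_term_le hd (mem_ball_zero_iff.mp hw).le j
  exact ((h.differentiableAt (Metric.isOpen_ball.mem_nhds (mem_ball_zero_iff.mpr hρ))).const_add
    1).differentiableWithinAt

/-- The zeros in `|w| ≤ ρ < 1` of all series with coefficients in `[0, μ]`, `μ ≤ 1`, form a closed
set, because the space of coefficient sequences is compact. -/
theorem isClosed_zeros_unitSeries {μ ρ : ℝ} (hμ : μ ≤ 1) (h0 : 0 ≤ ρ) (h1 : ρ < 1) :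
    IsClosed {w : ℂ | ‖w‖ ≤ ρ ∧ ∃ d : ℕ → ℝ, (∀ j, d j ∈ Set.Icc 0 μ) ∧ unitSeries d w = 0} := by
  have hcont : ContinuousOn (fun x : (ℕ → ℝ) × ℂ => unitSeries x.1 x.2)
      ((Set.univ.pi fun _ => Set.Icc 0 μ) ×ˢ Metric.closedBall 0 ρ) := by
    refine continuousOn_const.add (continuousOn_tsum (u := fun j => ρ ^ (j + 1)) (fun j => ?_)
      (summable_pow_succ h0 h1) ?_)
    · refine Continuous.continuousOn ?_
      fun_prop
    · rintro j ⟨d, w⟩ ⟨hd, hw⟩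
      refine norm_term_le (fun i => ?_) (by simpa using hw) j
      have := hd (i + 1) (Set.mem_univ _)
      rw [abs_of_nonneg this.1]
      exact this.2.trans hμ
  have hK : IsCompact ((Set.univ.pi fun _ : ℕ => Set.Icc 0 μ) ×ˢ Metric.closedBall (0 : ℂ) ρ) :=
    (isCompact_univ_pi fun _ => isCompact_Icc).prod (isCompact_closedBall _ _)
  have hZ := hcont.preimage_isClosed_of_isClosed hK.isClosed (isClosed_singleton (x := (0 : ℂ)))
  have hZc := (hK.of_isClosed_subset hZ Set.inter_subset_left).image continuous_snd
  convert hZc.isClosed using 1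
  ext w
  constructor
  · rintro ⟨hw, d, hd, hz⟩
    exact ⟨(d, w), ⟨⟨fun i _ => hd i, by simpa using hw⟩, hz⟩, rfl⟩
  · rintro ⟨⟨d, w⟩, ⟨⟨hd, hw⟩, hz⟩, rfl⟩
    exact ⟨by simpa using hw, d, fun i => hd i (Set.mem_univ i), hz⟩

/-- Series whose first `N` coefficients are `η`-close are close on the disc of radius `r² < 1`. The
radius is written as a square so that one factor `r` can be spent on the tail. -/
theorem norm_unitSeries_sub_le {d t : ℕ → ℝ} (hd : ∀ j, |d (j + 1)| ≤ 1) (ht : ∀ j, |t (j + 1)| ≤ 1)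
    (hdt1 : ∀ j, |t (j + 1) - d (j + 1)| ≤ 1) {r η : ℝ} (hr0 : 0 ≤ r) (hr1 : r < 1) (hη : 0 ≤ η) {N : ℕ}
    (hdt : ∀ i < N, |t (i + 1) - d (i + 1)| ≤ η) {w : ℂ} (hw : ‖w‖ ≤ r ^ 2) :
    ‖unitSeries t w - unitSeries d w‖ ≤ (η + r ^ N) / (1 - r) := by
  have hw1 : ‖w‖ < 1 := hw.trans_lt (by nlinarith)
  have heq : unitSeries t w - unitSeries d w
      = ∑' j : ℕ, ((t (j + 1) - d (j + 1) : ℝ) : ℂ) * w ^ (j + 1) := by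
    rw [unitSeries, unitSeries, add_sub_add_left_eq_sub,
      ← (summable_term ht hw1).tsum_sub (summable_term hd hw1)]
    congr 1
    ext j
    push_cast
    ring
  rw [heq, div_eq_mul_inv]
  refine tsum_of_norm_bounded ((hasSum_geometric_of_lt_one hr0 hr1).mul_left _) fun j => ?_
  rw [norm_mul, norm_pow, Complex.norm_real, Real.norm_eq_abs]
  have hpow : ‖w‖ ^ (j + 1) ≤ r ^ j * r ^ j := by
    calc ‖w‖ ^ (j + 1) ≤ ‖w‖ ^ j := pow_le_pow_of_le_one (norm_nonneg _) hw1.le (Nat.le_succ j)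
      _ ≤ (r ^ 2) ^ j := by gcongr
      _ = r ^ j * r ^ j := by rw [← pow_mul, two_mul, pow_add]
  have hrj1 : r ^ j ≤ 1 := pow_le_one₀ hr0 hr1.le
  have hrj0 : 0 ≤ r ^ j := pow_nonneg hr0 j
  have hrN : 0 ≤ r ^ N := pow_nonneg hr0 N
  rcases lt_or_ge j N with hj | hj
  · calc |t (j + 1) - d (j + 1)| * ‖w‖ ^ (j + 1) ≤ η * (r ^ j * r ^ j) := by
          gcongr
          exact hdt j hj
      _ ≤ η * (r ^ j * 1) := by gcongr
      _ ≤ (η + r ^ N) * r ^ j := by nlinarith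
  · calc |t (j + 1) - d (j + 1)| * ‖w‖ ^ (j + 1) ≤ 1 * (r ^ j * r ^ j) := by
          gcongr
          exact hdt1 j
      _ ≤ r ^ N * r ^ j := by
          rw [one_mul]
          gcongr ?_ * _
          exact pow_le_pow_of_le_one hr0 hr1.le hj
      _ ≤ (η + r ^ N) * r ^ j := by nlinarith

/-- Zeros in the unit disc persist under small changes of finitely many coefficients and arbitrary
changes of the remaining ones. -/
theorem exists_zero_of_coeff_close {d : ℕ → ℝ} (hd : ∀ j, d (j + 1) ∈ Set.Icc (0 : ℝ) 1) {w₀ : ℂ}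
    (hw₀ : ‖w₀‖ < 1) (hz : unitSeries d w₀ = 0) {ε : ℝ} (hε : 0 < ε) :
    ∃ η > 0, ∃ N : ℕ, ∀ t : ℕ → ℝ, (∀ j, t (j + 1) ∈ Set.Icc (0 : ℝ) 1) →
      (∀ i < N, |t (i + 1) - d (i + 1)| ≤ η) →
      ∃ w, ‖w - w₀‖ < ε ∧ ‖w‖ < 1 ∧ unitSeries t w = 0 := by
  have habs : ∀ {t : ℕ → ℝ}, (∀ j, t (j + 1) ∈ Set.Icc (0 : ℝ) 1) → ∀ j, |t (j + 1)| ≤ 1 :=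
    fun h j => by rw [abs_of_nonneg (h j).1]; exact (h j).2
  have hana : ∀ {t : ℕ → ℝ}, (∀ j, t (j + 1) ∈ Set.Icc (0 : ℝ) 1) →
      AnalyticOnNhd ℂ (unitSeries t) (Metric.ball 0 1) :=
    fun h => (differentiableOn_unitSeries (habs h)).analyticOnNhd Metric.isOpen_ball
  have hpre : IsPreconnected (Metric.ball (0 : ℂ) 1) := (convex_ball _ _).isPreconnected
  have hmem₀ : w₀ ∈ Metric.ball (0 : ℂ) 1 := mem_ball_zero_iff.mpr hw₀
  have h0mem : (0 : ℂ) ∈ Metric.ball (0 : ℂ) 1 := Metric.mem_ball_self one_pos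
  obtain ⟨r, hr0, hr1, hwr⟩ : ∃ r : ℝ, 0 ≤ r ∧ r < 1 ∧ ‖w₀‖ < r ^ 2 := by
    obtain ⟨x, hx, hx1⟩ := exists_between hw₀
    have hx0 := (norm_nonneg w₀).trans hx.le
    refine ⟨√x, Real.sqrt_nonneg x, ?_, by rwa [Real.sq_sqrt hx0]⟩
    rw [Real.sqrt_lt' one_pos]
    simpa using hx1
  -- The zero `w₀` is isolated, since the series takes the value `1` at the origin.
  have hiso : ∀ᶠ w in nhdsWithin w₀ {w₀}ᶜ, unitSeries d w ≠ 0 := by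
    by_contra hcon
    have hfreq : ∃ᶠ w in nhdsWithin w₀ {w₀}ᶜ, unitSeries d w = 0 := hcon
    have := (hana hd).eqOn_zero_of_preconnected_of_frequently_eq_zero hpre hmem₀ hfreq h0mem
    simp [unitSeries_zero] at this
  rw [eventually_nhdsWithin_iff] at hiso
  obtain ⟨δ, hδ, hiso⟩ := Metric.eventually_nhds_iff.mp hiso
  obtain ⟨s, hs0, hs⟩ := exists_between
    (lt_min (lt_min hδ hε) (sub_pos.mpr hwr) : 0 < min (min δ ε) (r ^ 2 - ‖w₀‖))
  have hsδ : s < δ := hs.trans_le ((min_le_left _ _).trans (min_le_left _ _))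
  have hsε : s < ε := hs.trans_le ((min_le_left _ _).trans (min_le_right _ _))
  have hsr : s < r ^ 2 - ‖w₀‖ := hs.trans_le (min_le_right _ _)
  have hball : ∀ w ∈ Metric.closedBall w₀ s, ‖w‖ ≤ r ^ 2 := by
    intro w hw
    have h1 : ‖w - w₀‖ ≤ s := by simpa [dist_eq_norm] using hw
    have h2 := norm_le_norm_add_norm_sub' w w₀
    linarith
  have hr2 : r ^ 2 < 1 := by nlinarith
  have hball1 : Metric.closedBall w₀ s ⊆ Metric.ball 0 1 := fun w hw =>
    mem_ball_zero_iff.mpr ((hball w hw).trans_lt hr2)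
  have hsph : w₀ + s ∈ Metric.sphere w₀ s := by
    simp [abs_of_pos hs0]
  obtain ⟨w₁, hw₁, hmin⟩ := (isCompact_sphere w₀ s).exists_isMinOn ⟨_, hsph⟩
    (((hana hd).continuousOn.mono (Metric.sphere_subset_closedBall.trans hball1)).norm)
  set m := ‖unitSeries d w₁‖ with hm
  have hm0 : 0 < m := by
    refine norm_pos_iff.mpr (hiso ?_ ?_)
    · rw [Metric.mem_sphere.mp hw₁]; exact hsδ
    · rintro rfl
      simp at hw₁
      exact hs0.ne hw₁
  -- On the circle the unperturbed series is at least `m` in norm, and perturbations by at most `m / 8`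
  -- keep the value at the centre small compared with the values on the circle; the open mapping
  -- estimate then yields a zero inside.
  have hpos : 0 < (1 - r) * (m / 16) := mul_pos (by linarith) (by positivity)
  obtain ⟨N, hN⟩ := exists_pow_lt_of_lt_one hpos hr1
  refine ⟨(1 - r) * (m / 16), hpos, N, fun t ht hdt => ?_⟩
  have hclose : ∀ w ∈ Metric.closedBall w₀ s, ‖unitSeries t w - unitSeries d w‖ ≤ m / 8 := by
    intro w hw
    refine (norm_unitSeries_sub_le (habs hd) (habs ht) (fun j => ?_) hr0 hr1 hpos.le hdt
      (hball w hw)).trans ?_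
    · have h1 := ht j
      have h2 := hd j
      rw [abs_le]
      constructor <;> linarith [h1.1, h1.2, h2.1, h2.2]
    · rw [div_le_iff₀ (by linarith)]
      linarith
  have ht₀ : ‖unitSeries t w₀‖ ≤ m / 8 := by
    simpa [hz] using hclose w₀ (Metric.mem_closedBall_self hs0.le)
  have hlow : ∀ w ∈ Metric.sphere w₀ s, m / 2 ≤ ‖unitSeries t w - unitSeries t w₀‖ := by
    intro w hw
    have h1 : m ≤ ‖unitSeries d w‖ := hmin hw
    have h2 := hclose w (Metric.sphere_subset_closedBall hw)
    have h3 := norm_sub_norm_le (unitSeries d w) (unitSeries t w)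
    rw [norm_sub_rev] at h3
    have h4 := norm_sub_norm_le (unitSeries t w) (unitSeries t w₀)
    linarith
  have hnonconst : ∃ᶠ w in nhds w₀, unitSeries t w ≠ unitSeries t w₀ := by
    intro hcon
    have hev : unitSeries t =ᶠ[nhds w₀] fun _ => unitSeries t w₀ := by
      simpa [Filter.EventuallyEq] using hcon
    have := (hana ht).eqOn_of_preconnected_of_eventuallyEq analyticOnNhd_const hpre hmem₀ hev
      (hball1 (Metric.sphere_subset_closedBall hsph))
    have h2 := hlow _ hsph
    rw [this, sub_self, norm_zero] at h2
    linarith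
  have hdiff : DiffContOnCl ℂ (unitSeries t) (Metric.ball w₀ s) := by
    refine DifferentiableOn.diffContOnCl ?_
    rw [closure_ball _ hs0.ne']
    exact (hana ht).differentiableOn.mono hball1
  obtain ⟨w, hw, hw0⟩ := hdiff.ball_subset_image_closedBall hs0 hlow hnonconst
    (show (0 : ℂ) ∈ Metric.ball _ _ by
      rw [Metric.mem_ball, dist_eq_norm, zero_sub, norm_neg]
      linarith)
  refine ⟨w, ?_, mem_ball_zero_iff.mp (hball1 hw), hw0⟩
  have : ‖w - w₀‖ ≤ s := by simpa [dist_eq_norm] using hw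
  linarith

/-! ### The generating function of the orbit of `1` -/

theorem abs_evenT_succ_le_one (α : ℝ) {β : ℝ} (hβ : 0 < β) (j : ℕ) : |evenT α β (j + 1)| ≤ 1 := by
  rw [abs_of_nonneg (evenT_nonneg α β _)]
  exact evenT_le_one α hβ _

/-- Summing the recursion `T^(2j+2) = αβ T^(2j) - b_j` over `j`. -/
theorem hasSum_blockDigit (α : ℝ) {β : ℝ} (hβ : 0 < β) {w : ℂ} (hw : ‖w‖ < 1) :
    HasSum (fun j => (blockDigit α β j : ℂ) * w ^ (j + 1))
      (1 - (1 - α * β * w) * unitSeries (evenT α β) w) := by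
  have h1 : HasSum (fun j => (evenT α β (j + 1) : ℂ) * w ^ (j + 1))
      (unitSeries (evenT α β) w - 1) := by
    rw [unitSeries, add_sub_cancel_left]
    exact (summable_term (abs_evenT_succ_le_one α hβ) hw).hasSum
  have h2 : HasSum (fun j => (evenT α β j : ℂ) * w ^ j) (unitSeries (evenT α β) w) := by
    rw [← hasSum_nat_add_iff' 1]
    simpa using h1
  have h3 := (h2.mul_left (α * β * w)).sub h1
  have hterm : (fun j => (blockDigit α β j : ℂ) * w ^ (j + 1)) = fun j =>
      α * β * w * ((evenT α β j : ℂ) * w ^ j) - (evenT α β (j + 1) : ℂ) * w ^ (j + 1) := by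
    funext j
    rw [evenT_succ]
    push_cast
    ring
  have hsum : 1 - (1 - α * β * w) * unitSeries (evenT α β) w =
      α * β * w * unitSeries (evenT α β) w - (unitSeries (evenT α β) w - 1) := by ring
  rw [hterm, hsum]
  exact h3

end CantorReal

/-! ### Conjugates of `α` and zeros of power series -/

/-- An eventually periodic power series is a rational function. -/
theorem one_sub_pow_mul_eq_of_eventually_periodic {b : ℕ → ℂ} {p k : ℕ}
    (hb : ∀ m, k ≤ m → b (m + p) = b m) {w S : ℂ} (hS : HasSum (fun j => b j * w ^ (j + 1)) S) :
    (1 - w ^ p) * S = ∑ j ∈ Finset.range (k + p), b j * w ^ (j + 1)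
      - w ^ p * ∑ j ∈ Finset.range k, b j * w ^ (j + 1) := by
  have h1 := hS.summable.sum_add_tsum_nat_add k
  have h2 := hS.summable.sum_add_tsum_nat_add (k + p)
  have htail : ∑' j, b (j + (k + p)) * w ^ (j + (k + p) + 1)
      = w ^ p * ∑' j, b (j + k) * w ^ (j + k + 1) := by
    rw [← tsum_mul_left]
    congr 1
    ext j
    rw [← add_assoc, hb (j + k) (Nat.le_add_left k j)]
    ring
  rw [htail] at h2
  rw [hS.tsum_eq] at h1 h2
  linear_combination w ^ p * h1 - h2

open Polynomial in
theorem IsConjRoot.aeval_inv_mul_eq_zero {K L : Type*} [Field K] [Field L] [Algebra K L] {a l : L}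
    (h : IsConjRoot K a l) (ha : a ≠ 0) (hl : l ≠ 0) (b : K) {P : K[X]}
    (hP : aeval (algebraMap K L b * a)⁻¹ P = 0) : aeval (algebraMap K L b * l)⁻¹ P = 0 := by
  have key : ∀ x : L, x ≠ 0 → (aeval (algebraMap K L b * x)⁻¹ P = 0 ↔
      aeval x (P.comp (C b⁻¹ * X)).reverse = 0) := by
    intro x hx
    let _ := invertibleOfNonzero (inv_ne_zero hx)
    have := eval₂_reverse_eq_zero_iff (algebraMap K L) x⁻¹ (P.comp (C b⁻¹ * X))
    rw [invOf_eq_inv, inv_inv] at this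
    rw [aeval_def x, this, ← aeval_def, aeval_comp, map_mul, aeval_C, aeval_X, map_inv₀,
      mul_inv_rev, mul_comm]
  rw [key l hl]
  obtain ⟨R, hR⟩ := minpoly.dvd K a ((key a ha).mp hP)
  rw [hR, map_mul, h.aeval_eq_zero, zero_mul]

namespace CantorReal

theorem algebraMap_gen (b : ℂ) :
    algebraMap ℚ⟮b⟯ ℂ (IntermediateField.AdjoinSimple.gen ℚ b) = b := rfl

open Polynomial in
/-- For `λ ∈ Φ(1, β)` conjugate to `α`, the series with coefficients `T^(2j) 1` vanishes at
`1 / (βλ)`: the periodic digits give a rational function over `ℚ(β)` which vanishes at `1 / (αβ)`,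
hence at `1 / (βλ)`, and whose factor `1 - αβw` vanishes only at the former point. -/
theorem exists_unitSeries_eq_zero_of_mem_Phi {β : ℝ} (hβ : 0 < β) {l : ℂ} (hl : l ∈ Phi 0 1 β) :
    ∃ α : ℝ, unitSeries (evenT α β) ((β * l)⁻¹) = 0 := by
  obtain ⟨hl1, α, hα, ⟨p, hp, k, hk⟩, -, hconj, hne⟩ := hl
  refine ⟨α, ?_⟩
  have hβ' : (β : ℂ) ≠ 0 := by exact_mod_cast hβ.ne'
  have hl0 : l ≠ 0 := by
    rintro rfl
    norm_num at hl1
  have hα0 : (α : ℂ) ≠ 0 := by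
    rintro h
    rw [Complex.ofReal_eq_zero] at h
    rw [h] at hα
    norm_num at hα
  set g := IntermediateField.AdjoinSimple.gen ℚ (β : ℂ) with hg
  set a := digit 0 (altBase α β) 1 with ha
  have hper : ∀ m, k ≤ m → blockDigit α β (m + p) = blockDigit α β m := by
    have h2 : ∀ m, k ≤ m → a (m + 2 * p) = a m := fun m hm => by
      rw [two_mul, ← add_assoc, hk _ (by omega), hk m hm]
    intro m hm
    rw [blockDigit, blockDigit, ← ha, show 2 * (m + p) = 2 * m + 2 * p by ring, h2 _ (by omega),
      show 2 * m + 2 * p + 1 = 2 * m + 1 + 2 * p by ring, h2 _ (by omega)]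
  let c : ℕ → ℚ⟮(β : ℂ)⟯ := fun j => g * a (2 * j) + a (2 * j + 1)
  have hc : ∀ j, algebraMap ℚ⟮(β : ℂ)⟯ ℂ (c j) = blockDigit α β j := fun j => by
    simp only [c, map_add, map_mul, map_intCast, hg, algebraMap_gen, blockDigit, ← ha]
    push_cast
    ring
  let E : ℚ⟮(β : ℂ)⟯[X] := 1 - X ^ p - (∑ j ∈ Finset.range (k + p), C (c j) * X ^ (j + 1)
    - X ^ p * ∑ j ∈ Finset.range k, C (c j) * X ^ (j + 1))
  have hE : ∀ w : ℂ, ‖w‖ < 1 →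
      aeval w E = (1 - w ^ p) * ((1 - α * β * w) * unitSeries (evenT α β) w) := by
    intro w hw
    have h := one_sub_pow_mul_eq_of_eventually_periodic (b := fun j => (blockDigit α β j : ℂ))
      (fun m hm => by rw [hper m hm]) (hasSum_blockDigit α hβ hw)
    have h2 : aeval w E = 1 - w ^ p
        - (∑ j ∈ Finset.range (k + p), (blockDigit α β j : ℂ) * w ^ (j + 1)
          - w ^ p * ∑ j ∈ Finset.range k, (blockDigit α β j : ℂ) * w ^ (j + 1)) := by
      simp only [E, map_sub, map_sum, map_mul, map_pow, map_one, aeval_X, aeval_C, hc]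
    rw [h2, ← h]
    ring
  have hwα : ‖((β : ℂ) * α)⁻¹‖ < 1 := by
    rw [norm_inv, ← Complex.ofReal_mul, Complex.norm_real, Real.norm_eq_abs, mul_comm β α]
    exact inv_lt_one_of_one_lt₀ hα
  have hwl : ‖((β : ℂ) * l)⁻¹‖ < 1 := by
    rw [norm_inv, mul_comm]
    exact inv_lt_one_of_one_lt₀ hl1
  have hEα : aeval ((β : ℂ) * α)⁻¹ E = 0 := by
    rw [hE _ hwα, mul_comm (α : ℂ) (β : ℂ), mul_inv_cancel₀ (mul_ne_zero hβ' hα0), sub_self,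
      zero_mul, mul_zero]
  have hEl : aeval ((β : ℂ) * l)⁻¹ E = 0 := by
    have := hconj.aeval_inv_mul_eq_zero hα0 hl0 g (P := E)
    rw [hg, algebraMap_gen] at this
    exact this hEα
  rw [hE _ hwl] at hEl
  rcases mul_eq_zero.mp hEl with h | h
  · exfalso
    have h1 : ‖((β : ℂ) * l)⁻¹ ^ p‖ < 1 := by
      rw [norm_pow]
      exact pow_lt_one₀ (norm_nonneg _) hwl hp.ne'
    rw [← sub_eq_zero.mp h, norm_one] at h1
    exact lt_irrefl _ h1
  · refine (mul_eq_zero.mp h).resolve_left fun h => hne ?_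
    field_simp at h
    simpa [sub_eq_zero] using h

open Polynomial in
/-- If the expansion of `1` consists of `N` blocks with second digits `0`, then `α` and the
reciprocals of the other zeros of `∑ T^(2j) w^j` (in the variable `βλ = 1 / w`) are roots of the same
polynomial over `ℚ(β)`. -/
theorem aeval_companionPoly_digit {α β : ℝ} (hβ : 0 < β) {N : ℕ}
    (hodd : ∀ i, digit 0 (altBase α β) 1 (2 * i + 1) = 0)
    (hT : T 0 (altBase α β) (2 * N) 1 = 0) {w : ℂ} (hw0 : w ≠ 0) (hw : ‖w‖ < 1) :
    aeval (β * w)⁻¹ (companionPoly N fun i => (digit 0 (altBase α β) 1 (2 * i) : ℚ⟮(β : ℂ)⟯) *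
        (IntermediateField.AdjoinSimple.gen ℚ (β : ℂ))⁻¹ ^ i) =
      (β * w)⁻¹ ^ N * ((1 - α * β * w) * unitSeries (evenT α β) w) := by
  have hβ' : (β : ℂ) ≠ 0 := by exact_mod_cast hβ.ne'
  have hfin : HasSum (fun j => (blockDigit α β j : ℂ) * w ^ (j + 1))
      (∑ j ∈ Finset.range N, (blockDigit α β j : ℂ) * w ^ (j + 1)) :=
    hasSum_sum_of_ne_finset_zero fun j hj => by
      rw [Finset.mem_range, not_lt] at hj
      rw [blockDigit, digit_eq_zero_of_le hT (by omega), digit_eq_zero_of_le hT (by omega)]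
      simp
  have heq := hfin.unique (hasSum_blockDigit α hβ hw)
  have h1 : (1 - α * β * w) * unitSeries (evenT α β) w =
      1 - ∑ j ∈ Finset.range N, (blockDigit α β j : ℂ) * w ^ (j + 1) := by
    rw [heq]
    ring
  rw [h1, companionPoly, map_sub, map_pow, aeval_X, mul_sub, mul_one, map_sum, Finset.mul_sum]
  congr 1
  refine Finset.sum_congr rfl fun i hi => ?_
  have hiN := Finset.mem_range.mp hi
  rw [map_mul, aeval_C, map_pow, aeval_X, map_mul, map_intCast, map_pow, map_inv₀, algebraMap_gen,
    blockDigit, hodd]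
  have hsplit : ((β : ℂ) * w)⁻¹ ^ N = (β * w)⁻¹ ^ (N - 1 - i) * (β * w)⁻¹ ^ (i + 1) := by
    rw [← pow_add]
    congr 1
    omega
  have hw1 : ((β : ℂ) * w)⁻¹ ^ (i + 1) * w ^ (i + 1) = (β : ℂ)⁻¹ ^ (i + 1) := by
    rw [← mul_pow, mul_inv, inv_mul_cancel_right₀ hw0]
  have hβ1 : (β : ℂ)⁻¹ ^ (i + 1) * β = (β : ℂ)⁻¹ ^ i := by
    rw [pow_succ, inv_mul_cancel_right₀ hβ']
  rw [hsplit, ← hβ1, ← hw1]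
  push_cast
  ring

/-- Reciprocals of zeros of series with coefficients in `[0, min 1 β]` are limits of conjugates. -/
theorem inv_mem_closure_Phi {β : ℝ} (hβ : 0 < β) {d : ℕ → ℝ}
    (hd : ∀ j, d (j + 1) ∈ Set.Icc 0 (min 1 β)) {w₀ : ℂ} (hw₀ : ‖w₀‖ < 1)
    (hz : unitSeries d w₀ = 0) : (β * w₀)⁻¹ ∈ closure (Phi 0 1 β) := by
  have hβ' : (β : ℂ) ≠ 0 := by exact_mod_cast hβ.ne'
  have hne0 : ∀ {t : ℕ → ℝ} {w : ℂ}, unitSeries t w = 0 → w ≠ 0 := by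
    rintro t w h rfl
    rw [unitSeries_zero] at h
    exact one_ne_zero h
  have hw₀0 := hne0 hz
  have hμ0 : 0 < min 1 β := lt_min one_pos hβ
  rw [Metric.mem_closure_iff]
  intro ε hε
  have hcont : ContinuousAt (fun w : ℂ => ((β : ℂ) * w)⁻¹) w₀ :=
    (continuousAt_const.mul continuousAt_id).inv₀ (mul_ne_zero hβ' hw₀0)
  obtain ⟨ε', hε', hcl⟩ := Metric.continuousAt_iff.mp hcont ε hε
  obtain ⟨η, hη, N, hN⟩ := exists_zero_of_coeff_close
    (fun j => ⟨(hd j).1, (hd j).2.trans (min_le_left _ _)⟩) hw₀ hz hε'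
  obtain ⟨q, hq, φ, hφ⟩ := exists_ringHom_padic_norm_gen_eq_one hβ'
  -- Shrink the coefficients slightly, to leave room inside `[0, min 1 β)`.
  set η' := min η 1 with hη'def
  have hη'0 : 0 < η' := lt_min hη one_pos
  have hη'1 : η' ≤ 1 := min_le_right _ _
  obtain ⟨α, hαA, hIcc, hodd, hdvd, hndvd, hT⟩ := exists_finite_expansion hβ
    (l := fun i => (1 - η') * d (i + 1))
    (h := fun i => (1 - η') * d (i + 1) + η' * (min 1 β) / 2)
    (κ := η' * (min 1 β) / 2) (by positivity)
    (fun i => mul_nonneg (by linarith) (hd i).1) (fun i => le_rfl)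
    (fun i => by
      have h1 : (1 - η') * d (i + 1) ≤ (1 - η') * min 1 β :=
        mul_le_mul_of_nonneg_left (hd i).2 (by linarith)
      nlinarith [mul_pos hη'0 hμ0])
    hq.out.one_lt (max (2 / β) (‖((β : ℂ) * w₀)⁻¹‖ + ε)) N
  obtain ⟨w, hww₀, hw1, hwz⟩ := hN (evenT α β)
    (fun j => ⟨evenT_nonneg α β _, evenT_le_one α hβ _⟩) (fun i hi => by
      have h1 := (hIcc i hi).1
      have h2 := (hIcc i hi).2
      have h3 := (hd i).1
      have h4 : d (i + 1) ≤ 1 := (hd i).2.trans (min_le_left _ _)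
      have h5 : min 1 β ≤ 1 := min_le_left _ _
      have h6 : η' ≤ η := min_le_left _ _
      rw [abs_le]
      constructor <;> nlinarith)
  have hw0 := hne0 hwz
  have hdist : dist ((β : ℂ) * w₀)⁻¹ ((β : ℂ) * w)⁻¹ < ε := by
    rw [dist_comm]
    exact hcl (by rwa [dist_eq_norm])
  have hαβ : 1 < α * β := by
    have := (le_max_left _ _).trans hαA
    rw [div_le_iff₀ hβ] at this
    linarith
  have hα0 : 0 < α := pos_of_mul_pos_left (zero_lt_one.trans hαβ) hβ.le
  have hα0' : (α : ℂ) ≠ 0 := by exact_mod_cast hα0.ne'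
  set Q := companionPoly (N + 1) fun i =>
    (digit 0 (altBase α β) 1 (2 * i) : ℚ⟮(β : ℂ)⟯) *
      (IntermediateField.AdjoinSimple.gen ℚ (β : ℂ))⁻¹ ^ i with hQ
  have hirr : Irreducible Q := companionPoly_irreducible_of_padic φ hφ N.succ_pos hdvd hndvd
  have hmonic : Q.Monic := companionPoly.monic _ _
  have hQw : Polynomial.aeval ((β : ℂ) * w)⁻¹ Q = 0 := by
    rw [hQ, aeval_companionPoly_digit hβ hodd hT hw0 hw1, hwz, mul_zero, mul_zero]
  have hQα : Polynomial.aeval (α : ℂ) Q = 0 := by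
    have hα' : (α : ℂ) = ((β : ℂ) * ((α : ℂ) * β)⁻¹)⁻¹ := by field_simp
    have hnorm : ‖((α : ℂ) * β)⁻¹‖ < 1 := by
      rw [norm_inv, ← Complex.ofReal_mul, Complex.norm_real, Real.norm_eq_abs]
      exact inv_lt_one_of_one_lt₀ (hαβ.trans_le (le_abs_self _))
    have hαβ0 : (α : ℂ) * β ≠ 0 := mul_ne_zero hα0' hβ'
    rw [hα', hQ, aeval_companionPoly_digit hβ hodd hT (inv_ne_zero hαβ0) hnorm,
      mul_inv_cancel₀ hαβ0, sub_self, zero_mul, mul_zero]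
  refine ⟨((β : ℂ) * w)⁻¹, ⟨?_, α, hαβ.trans_le (le_abs_self _), ⟨1, one_pos, 2 * (N + 1), ?_⟩,
    ⟨Q, hmonic.ne_zero, hQα⟩, ?_, ?_⟩, hdist⟩
  · have : ((β : ℂ) * w)⁻¹ * β = w⁻¹ := by field_simp
    rw [this, norm_inv]
    exact (one_lt_inv₀ (norm_pos_iff.mpr hw0)).mpr hw1
  · intro m hm
    rw [digit_eq_zero_of_le hT hm, digit_eq_zero_of_le hT (hm.trans (Nat.le_succ m))]
  · rw [isConjRoot_def, ← minpoly.eq_of_irreducible_of_monic hirr hQα hmonic,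
      ← minpoly.eq_of_irreducible_of_monic hirr hQw hmonic]
  · intro h
    rw [h] at hdist
    have h1 := (le_max_right _ _).trans hαA
    have h2 : ‖(α : ℂ)‖ = α := by rw [Complex.norm_real, Real.norm_of_nonneg hα0.le]
    have h3 := norm_sub_norm_le (α : ℂ) ((β : ℂ) * w₀)⁻¹
    rw [dist_comm, dist_eq_norm] at hdist
    linarith

/-- Both ranges of `β` at once: the coefficient interval is `[0, min 1 β]`. -/
theorem closure_Phi_inter_eq {β : ℝ} (hβ : 0 < β) :
    closure (Phi 0 1 β) ∩ {l : ℂ | 1 / β < ‖l‖} =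
      recip (zerosIn β (seriesFamily (Set.Icc 0 (min 1 β)) 1 β)) := by
  have hβ' : (β : ℂ) ≠ 0 := by exact_mod_cast hβ.ne'
  ext l
  constructor
  · rintro ⟨hcl, hl⟩
    have hl' : 1 < β * ‖l‖ := by
      have : 1 / β < ‖l‖ := hl
      rwa [div_lt_iff₀' hβ] at this
    have hl0 : l ≠ 0 := by
      rintro rfl
      norm_num at hl'
    have hw1 : ‖((β : ℂ) * l)⁻¹‖ < 1 := by
      rw [norm_inv, norm_mul, Complex.norm_real, Real.norm_of_nonneg hβ.le]
      exact inv_lt_one_of_one_lt₀ hl'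
    obtain ⟨ρ, hwρ, hρ1⟩ := exists_between hw1
    have hcont : Filter.Tendsto (fun l : ℂ => ((β : ℂ) * l)⁻¹) (nhds l) (nhds ((β : ℂ) * l)⁻¹) :=
      (continuousAt_const.mul continuousAt_id).inv₀ (mul_ne_zero hβ' hl0)
    have hmem := (isClosed_zeros_unitSeries (min_le_left 1 β) ((norm_nonneg _).trans hwρ.le)
      hρ1).mem_of_frequently_of_tendsto
        (((mem_closure_iff_frequently.mp hcl).and_eventually
          (hcont.norm.eventually_lt_const hwρ)).mono fun l' hl' => ?_) hcont
    · obtain ⟨-, d, hd, hz⟩ := hmem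
      refine ⟨1 / l, ⟨?_, _, ⟨d, fun j _ => hd j, rfl⟩, ?_⟩, one_div_one_div l⟩
      · rw [norm_div, norm_one, abs_of_pos hβ, div_lt_iff₀ (norm_pos_iff.mpr hl0)]
        exact hl'
      · rw [seriesFun_eq_unitSeries, ← hz]
        congr 1
        field_simp
    · obtain ⟨α, hα⟩ := exists_unitSeries_eq_zero_of_mem_Phi hβ hl'.1
      -- The value at index `0`, which `unitSeries` does not use, is replaced: `evenT α β 0 = 1` need
      -- not lie in `[0, min 1 β]`.
      refine ⟨hl'.2.le, fun j => if j = 0 then 0 else evenT α β j, fun j => ?_, ?_⟩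
      · rcases j with _ | j
        · simpa using hβ.le
        · simpa using ⟨evenT_nonneg α β (j + 1), le_min_iff.mp (evenT_succ_lt α hβ j).le⟩
      · simpa [unitSeries] using hα
  · rintro ⟨z, ⟨hz, f, ⟨d, hd, rfl⟩, hfz⟩, rfl⟩
    rw [abs_of_pos hβ] at hz
    rw [seriesFun_eq_unitSeries] at hfz
    have hz0 : z ≠ 0 := by
      rintro rfl
      simp [unitSeries_zero] at hfz
    have hw : ‖z / (β : ℂ)‖ < 1 := by
      rw [norm_div, Complex.norm_real, Real.norm_of_nonneg hβ.le, div_lt_one hβ]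
      exact hz
    refine ⟨?_, ?_⟩
    · have := inv_mem_closure_Phi hβ (fun j => hd (j + 1) (Nat.le_add_left 1 j)) hw hfz
      rwa [mul_div_cancel₀ _ hβ', ← one_div] at this
    · change 1 / β < ‖1 / z‖
      rw [norm_div, norm_one]
      exact one_div_lt_one_div_of_lt (norm_pos_iff.mpr hz0) hz

end CantorReal

/-- Closures are taken within the region `|l| > 1 / β`. -/
theorem theorem3p8 (β : ℝ) (hβ : 0 < β) :
    (1 ≤ β →
      closure (CantorReal.Phi 0 1 β) ∩ {l : ℂ | 1 / β < ‖l‖} =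
        CantorReal.recip (CantorReal.G 0 1 β)) ∧
    (β < 1 →
      closure (CantorReal.Phi 0 1 β) ∩ {l : ℂ | 1 / β < ‖l‖} =
        CantorReal.recip (CantorReal.G' 1 β)) := by
  constructor
  · intro h
    rw [CantorReal.closure_Phi_inter_eq hβ, min_eq_left h, CantorReal.G, zero_add]
  · intro h
    rw [CantorReal.closure_Phi_inter_eq hβ, min_eq_right h.le, CantorReal.G']
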